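/- Let $\Gamma=(V,E)$ be a simplicial graph (undirected, no loops, no multiple edges) and let $\mathcal A$ be a unital $C^*$-algebra with center $\mathcal Z(\mathcal A)$. For an action $\alpha:G\to\operatorname{Aut}(\mathcal A)$ of a discrete group $G$, a map $h:G\to\mathcal Z(\mathcal A)$ is called a positive definite multiplier for $\alpha$ if for every $n\in\mathbb N$ and $x_1,\dots,x_n\in G$ the matrix $[\alpha_{x_j}(h_{x_i^{-1}x_j})]_{i,j}$ is positive in $\mathbb M_n(\mathcal A)$; it is unital if $h_e=1_{\mathcal A}$. For each $v\in V$ let $G_v$ be a discrete group, $\alpha_v:G_v\curvearrowright\mathcal A$ an action, and $h_v:G_v\to\mathcal Z(\mathcal A)$ a unital positive definite multiplier for $\alpha_v$. Suppose that these commute according to $\Gamma$, that is, whenever $(v,w)\in E$, $a\in G_v$ and $b\in G_w$, $$\alpha_{v}(a)\,\alpha_{w}(b)=\alpha_{w}(b)\,\alpha_{v}(a),\qquad \alpha_{v,a}(h_{w,b})=h_{w,b},\qquad \alpha_{w,b}(h_{v,a})=h_{v,a}.$$ Let $\bigstar_\Gamma G_v$ be the free product of the $G_v$ modulo the relations $[g,h]=1$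 for $g\in G_v$, $h\in G_w$, $(v,w)\in E$, and let $\alpha=\bigstar_\Gamma\alpha_v:\bigstar_\Gamma G_v\curvearrowright\mathcal A$ be the action which restricts to $\alpha_v$ on each $G_v$. Call an expression $s_1\cdots s_n$ with $s_j\in G_{v_j}\setminus\{e\}$ a reduced word if whenever $v_k=v_l$ with $k<l$, there is $p$ with $k<p<l$ and $(v_k,v_p)\notin E$ (the empty word is reduced). Every element of $\bigstar_\Gamma G_v$ is represented by a reduced word. Then setting, for every reduced word $s=s_1\cdots s_n$ with $s_j\in G_{v_j}$, $$(\bigstar_\Gamma h_v)_{s}=\alpha_{p_1}^{-1}(h_{v_1,s_1})\cdots\alpha_{p_{n-1}}^{-1}(h_{v_{n-1},s_{n-1}})\,h_{v_n,s_n},\qquad p_j=s_{j+1}\cdots s_n,$$ (with value $1_{\mathcal A}$ for the empty word) gives a well-defined map on $\bigstar_\Gamma G_v$, with values in $\mathcal Z(\mathcal A)$, and $\bigstar_\Gamma h_v$ is a positive definite multiplier for the action $\bigstar_\Gamma\alpha_v$ of $\bigstar_\Gamma G_v$ on $\mathcal A$. -/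

import Mathlib

open scoped commutatorElement

namespace GraphProd

section Groups

variable {V : Type*} (Γ : SimpleGraph V) (G : V → Type*) [∀ v, Group (G v)]

/-- The commutators `[g, h]`, with `g ∈ G v`, `h ∈ G w` and `v`, `w` adjacent, in the free product
of the groups `G v`. -/
def relators : Set (Monoid.CoprodI G) :=
  {x | ∃ v w : V, Γ.Adj v w ∧ ∃ (g : G v) (h : G w),
    x = ⁅(Monoid.CoprodI.of g : Monoid.CoprodI G), (Monoid.CoprodI.of h : Monoid.CoprodI G)⁆}

/-- The graph product of the groups `G v`: their free product modulo the relations `[g, h] = 1`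
whenever `g ∈ G v`, `h ∈ G w` and `v`, `w` are adjacent in `Γ`. -/
abbrev GraphProduct : Type _ :=
  Monoid.CoprodI G ⧸ Subgroup.normalClosure (relators Γ G)

variable {G}

/-- The canonical homomorphism of a vertex group into the graph product. -/
def of (v : V) : G v →* GraphProduct Γ G :=
  (QuotientGroup.mk' (Subgroup.normalClosure (relators Γ G))).comp Monoid.CoprodI.of

theorem commute_of {v w : V} (hvw : Γ.Adj v w) (g : G v) (h : G w) :
    Commute (of Γ v g) (of Γ w h) := by
  rw [← commutatorElement_eq_one_iff_commute]
  have hmem : ⁅(Monoid.CoprodI.of g : Monoid.CoprodI G), (Monoid.CoprodI.of h : Monoid.CoprodI G)⁆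
      ∈ Subgroup.normalClosure (relators Γ G) :=
    Subgroup.subset_normalClosure ⟨v, w, hvw, g, h, rfl⟩
  rw [← QuotientGroup.eq_one_iff] at hmem
  exact hmem

/-- The universal property of the graph product of groups. -/
def lift {N : Type*} [Group N] (f : ∀ v, G v →* N)
    (hf : ∀ v w, Γ.Adj v w → ∀ (g : G v) (h : G w), f v g * f w h = f w h * f v g) :
    GraphProduct Γ G →* N :=
  QuotientGroup.lift (Subgroup.normalClosure (relators Γ G)) (Monoid.CoprodI.lift f) (by
    have hle : Subgroup.normalClosure (relators Γ G) ≤ (Monoid.CoprodI.lift f).ker := by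
      refine Subgroup.normalClosure_le_normal ?_
      rintro x ⟨v, w, hvw, g, h, rfl⟩
      change Monoid.CoprodI.lift f _ = 1
      rw [map_commutatorElement, Monoid.CoprodI.lift_of, Monoid.CoprodI.lift_of,
        commutatorElement_eq_one_iff_commute]
      exact hf v w hvw g h
    exact hle)

@[simp]
theorem lift_of {N : Type*} [Group N] (f : ∀ v, G v →* N)
    (hf : ∀ v w, Γ.Adj v w → ∀ (g : G v) (h : G w), f v g * f w h = f w h * f v g)
    (v : V) (g : G v) : lift Γ f hf (of Γ v g) = f v g :=
  Monoid.CoprodI.lift_of f g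

/-- A word `(v₁, …, vₙ)` of vertices is reduced if whenever `v_k = v_l` with `k < l`, there is a
`p` with `k < p < l` such that `v_k` and `v_p` are not adjacent. -/
def IsReducedVertexWord (w : List V) : Prop :=
  ∀ k l : Fin w.length, k < l → w.get k = w.get l →
    ∃ p : Fin w.length, k < p ∧ p < l ∧ ¬ Γ.Adj (w.get k) (w.get p)

/-- A word `s₁ ⋯ sₙ` with letters `s_j ∈ G v_j` is reduced if its letters are nontrivial and its
vertex word `(v₁, …, vₙ)` is reduced. -/
def IsReduced (w : List (Σ v, G v)) : Prop :=
  (∀ x ∈ w, x.2 ≠ 1) ∧ IsReducedVertexWord Γ (w.map Sigma.fst)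

/-- The element `s₁ ⋯ sₙ` of the graph product given by a word. -/
def wordProd (w : List (Σ v, G v)) : GraphProduct Γ G :=
  (w.map fun x => of Γ x.1 x.2).prod

@[simp]
theorem wordProd_nil : wordProd Γ ([] : List (Σ v, G v)) = 1 := rfl

@[simp]
theorem wordProd_cons (x : Σ v, G v) (w : List (Σ v, G v)) :
    wordProd Γ (x :: w) = of Γ x.1 x.2 * wordProd Γ w := by
  simp [wordProd]

@[simp]
theorem wordProd_append (w w' : List (Σ v, G v)) :
    wordProd Γ (w ++ w') = wordProd Γ w * wordProd Γ w' := by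
  simp [wordProd]

theorem exists_wordProd (s : GraphProduct Γ G) : ∃ w : List (Σ v, G v), wordProd Γ w = s := by
  obtain ⟨y, rfl⟩ := QuotientGroup.mk_surjective s
  induction y using Monoid.CoprodI.induction_on with
  | one => exact ⟨[], rfl⟩
  | of v g => exact ⟨[⟨v, g⟩], by simp [of]⟩
  | mul x y hx hy =>
    obtain ⟨a, ha⟩ := hx
    obtain ⟨b, hb⟩ := hy
    exact ⟨a ++ b, by rw [wordProd_append, ha, hb]; rfl⟩

theorem exists_split {α : Type*} (w : List α) (k l : ℕ) (hkl : k < l) (hl : l < w.length) :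
    ∃ a m b, w = a ++ w[k] :: (m ++ w[l] :: b) ∧
      ∀ x ∈ m, ∃ (p : ℕ) (hp : p < w.length), k < p ∧ p < l ∧ x = w[p] := by
  refine ⟨w.take k, (w.take l).drop (k + 1), w.drop (l + 1), ?_, ?_⟩
  · have h1 : w[l] :: w.drop (l + 1) = w.drop l := List.getElem_cons_drop hl
    have h2 : w[k] :: (w.take l).drop (k + 1) = (w.take l).drop k := by
      have := List.getElem_cons_drop (as := w.take l) (i := k) (by simp; omega)
      simpa using this
    have h3 : w.take k ++ (w.take l).drop k = w.take l := by
      have := List.take_append_drop k (w.take l)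
      rwa [List.take_take, min_eq_left hkl.le] at this
    rw [h1, ← List.cons_append, h2, ← List.append_assoc, h3, List.take_append_drop]
  · intro x hx
    obtain ⟨i, hi, rfl⟩ := List.mem_iff_getElem.1 hx
    simp only [List.length_drop, List.length_take] at hi
    exact ⟨k + 1 + i, by omega, by omega, by omega, by simp⟩

theorem commute_wordProd (v : V) (g : G v) (m : List (Σ v, G v)) (hm : ∀ x ∈ m, Γ.Adj v x.1) :
    Commute (of Γ v g) (wordProd Γ m) := by
  induction m with
  | nil => exact Commute.one_right _
  | cons x m ih =>
    rw [wordProd_cons]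
    exact (commute_of Γ (hm x (by simp)) g x.2).mul_right (ih fun y hy => hm y (by simp [hy]))

/-- Every element of the graph product is represented by a reduced word. -/
theorem exists_isReduced (s : GraphProduct Γ G) :
    ∃ w : List (Σ v, G v), IsReduced Γ w ∧ wordProd Γ w = s := by
  obtain ⟨w₀, hw₀⟩ := exists_wordProd Γ s
  induction hn : w₀.length using Nat.strong_induction_on generalizing w₀ with
  | _ n ih =>
    by_cases hred : IsReduced Γ w₀
    · exact ⟨w₀, hred, hw₀⟩
    unfold IsReduced at hred
    rw [not_and_or] at hred
    rcases hred with h | h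
    · push Not at h
      obtain ⟨x, hx, hx1⟩ := h
      obtain ⟨a, b, rfl⟩ := List.append_of_mem hx
      refine ih (a ++ b).length ?_ (a ++ b) ?_ rfl
      · simp at hn ⊢
        omega
      · simpa [hx1] using hw₀
    · unfold IsReducedVertexWord at h
      push Not at h
      obtain ⟨k, l, hkl, heq, hadj⟩ := h
      have hl : (l : ℕ) < w₀.length := by simpa using l.2
      have hk : (k : ℕ) < w₀.length := by simpa using k.2
      simp only [List.get_eq_getElem, List.getElem_map] at heq hadj
      obtain ⟨a, m, b, hw, hm⟩ := exists_split w₀ k l hkl hl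
      have hm' : ∀ x ∈ m, Γ.Adj (w₀[(k : ℕ)]).1 x.1 := by
        intro x hx
        obtain ⟨p, hp, h1, h2, rfl⟩ := hm x hx
        exact hadj ⟨p, by simpa using hp⟩ h1 h2
      generalize w₀[(k : ℕ)] = xk at *
      generalize w₀[(l : ℕ)] = xl at *
      obtain ⟨v, g⟩ := xk
      obtain ⟨v', g'⟩ := xl
      obtain rfl : v = v' := heq
      subst hw
      refine ih _ ?_ (a ++ ⟨v, g * g'⟩ :: (m ++ b)) ?_ rfl
      · simp at hn ⊢
        omega
      · rw [← hw₀]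
        have hc := (commute_wordProd Γ v g' m hm').eq
        simp only [wordProd_append, wordProd_cons, map_mul, mul_assoc]
        rw [← mul_assoc (of Γ v g') (wordProd Γ m), hc, mul_assoc]

end Groups

section Multipliers

variable {A : Type*} [CStarAlgebra A]

/-- `h : H → Z(A)` is a positive definite multiplier for the action `α` of the group `H` on the
unital C⋆-algebra `A`: it takes its values in the center of `A`, and for all `x₁, …, xₙ` in `H` the
matrix with `(i, j)` entry `α_{x_j}(h(x_i⁻¹ x_j))` is positive in the C⋆-algebra `M_n(A)`. -/
structure IsPosDefMultiplier [PartialOrder A] [StarOrderedRing A] {H : Type*} [Group H]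
    (α : H →* (A ≃⋆ₐ[ℂ] A)) (h : H → A) : Prop where
  mem_center : ∀ s, h s ∈ Set.center A
  nonneg : ∀ (n : ℕ) (x : Fin n → H),
    0 ≤ (CStarMatrix.ofMatrix (Matrix.of fun i j => α (x j) (h ((x i)⁻¹ * x j))) :
      CStarMatrix (Fin n) (Fin n) A)

/-- A multiplier is unital if its value at the identity is `1`. -/
def IsUnitalMultiplier {H : Type*} [Group H] (h : H → A) : Prop := h 1 = 1

/-- Two multipliers (for commuting actions) commute if each action fixes the values of the other
multiplier. -/
def MultipliersCommute {H₁ H₂ : Type*} [Group H₁] [Group H₂]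
    (α₁ : H₁ →* (A ≃⋆ₐ[ℂ] A)) (α₂ : H₂ →* (A ≃⋆ₐ[ℂ] A)) (h₁ : H₁ → A) (h₂ : H₂ → A) : Prop :=
  (∀ (a : H₁) (b : H₂), α₁ a (h₂ b) = h₂ b) ∧ (∀ (a : H₂) (b : H₁), α₂ a (h₁ b) = h₁ b)

variable {V : Type*} (Γ : SimpleGraph V) {G : V → Type*} [∀ v, Group (G v)]

/-- The actions `α v` of the groups `G v` on `A` commute according to `Γ`. -/
def ActionsCommuteAccordingTo (α : ∀ v, G v →* (A ≃⋆ₐ[ℂ] A)) : Prop :=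
  ∀ v w, Γ.Adj v w → ∀ (g : G v) (h : G w), α v g * α w h = α w h * α v g

/-- The multipliers `h v` commute according to `Γ`. -/
def MultipliersCommuteAccordingTo (α : ∀ v, G v →* (A ≃⋆ₐ[ℂ] A)) (h : ∀ v, G v → A) : Prop :=
  ∀ v w, Γ.Adj v w → MultipliersCommute (α v) (α w) (h v) (h w)

/-- The graph product action of `★_Γ G_v` on `A`. -/
def graphProductAction (α : ∀ v, G v →* (A ≃⋆ₐ[ℂ] A)) (hα : ActionsCommuteAccordingTo Γ α) :
    GraphProduct Γ G →* (A ≃⋆ₐ[ℂ] A) :=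
  lift Γ α hα

/-- For a word `s₁ ⋯ sₙ` with `s_j ∈ G v_j`, the element
`β(p₁)⁻¹(h_{v₁}(s₁)) ⋯ β(p_{n-1})⁻¹(h_{v_{n-1}}(s_{n-1})) h_{v_n}(s_n)` of `A`, where
`p_j = s_{j+1} ⋯ s_n`. -/
def wordMultiplier (β : GraphProduct Γ G →* (A ≃⋆ₐ[ℂ] A)) (h : ∀ v, G v → A) :
    List (Σ v, G v) → A
  | [] => 1
  | x :: w => (β (wordProd Γ w))⁻¹ (h x.1 x.2) * wordMultiplier β h w

/-- The graph product multiplier `★_Γ h_v`: its value at `s` is `wordMultiplier` of a reduced word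
representing `s`. (The word is chosen; that the value does not depend on it is a fact about
multipliers that commute according to `Γ`, not part of this definition.) -/
noncomputable def graphProductMultiplier (α : ∀ v, G v →* (A ≃⋆ₐ[ℂ] A))
    (hα : ActionsCommuteAccordingTo Γ α) (h : ∀ v, G v → A) (s : GraphProduct Γ G) : A :=
  wordMultiplier Γ (graphProductAction Γ α hα) h (exists_isReduced Γ s).choose

end Multipliers

end GraphProd

/-! Well-definedness rests on the normal form theorem (`shuffle_of_wordProd_eq`): reduced words for
the same element differ only by exchanging neighbouring letters from adjacent vertex groups. Such an
exchange does not change the word formula, because each of the two letters fixes the multiplier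
value of the other and all values are central (`Shuffle.wordMultiplier_eq`). The normal form theorem
itself comes from van der Waerden's trick: the graph product acts by left multiplication on shuffle
classes of reduced words, and the element of a reduced word sends the empty class to the class of
that word.

Positivity of the kernel K(s, t) = α_t(h(s⁻¹t)) on finitely many points is proved by induction on
the sum of their lengths. If all points are trivial, every entry is 1. Otherwise there is a coset p
G_v lying as far out as possible (`exists_outermost_coset`): a point with a nontrivial G_v component
a over this coset has the form p a u with u a product over the link of v, and it can be shortened to
p u; every other point is kept and gets a = 1. The kernel then factors (`multiplier_kernel_eq_mul`)
as K(s, t) = K(s', t') · α_p(α_b(h_v(a⁻¹b))), where s', t' are the shortened points and a, b the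
components. The first factor is positive by induction, the second is the image under α_p of a
positive matrix of the vertex multiplier, and the Schur product of positive matrices is positive
when one has central entries (`nonneg_hadamard_of_mem_center`). -/

namespace GraphProd

/-! ### Combinatorics of words up to shuffling -/

section Words

variable {V : Type*} (Γ : SimpleGraph V) {G : V → Type*}

/-- No letter of the vertex group `G v` can be shuffled to the front of the word. -/
def FrontFree (v : V) : List (Σ v, G v) → Prop
  | [] => True
  | y :: w => y.1 ≠ v ∧ (Γ.Adj v y.1 → FrontFree v w)

/-- Equality of words up to exchanging neighbouring letters from adjacent vertex groups. -/
inductive Shuffle : List (Σ v, G v) → List (Σ v, G v) → Prop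
  | nil : Shuffle [] []
  | cons (x : Σ v, G v) {w w' : List (Σ v, G v)} : Shuffle w w' → Shuffle (x :: w) (x :: w')
  | swap (x y : Σ v, G v) (w : List (Σ v, G v)) : Γ.Adj x.1 y.1 →
      Shuffle (x :: y :: w) (y :: x :: w)
  | trans {w₁ w₂ w₃ : List (Σ v, G v)} : Shuffle w₁ w₂ → Shuffle w₂ w₃ → Shuffle w₁ w₃

variable {Γ}

@[simp]
theorem frontFree_nil (v : V) : FrontFree Γ v ([] : List (Σ v, G v)) := trivial

theorem frontFree_cons {v : V} {y : Σ v, G v} {w : List (Σ v, G v)} :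
    FrontFree Γ v (y :: w) ↔ y.1 ≠ v ∧ (Γ.Adj v y.1 → FrontFree Γ v w) := Iff.rfl

theorem Shuffle.refl (w : List (Σ v, G v)) : Shuffle Γ w w := by
  induction w with
  | nil => exact .nil
  | cons x w ih => exact .cons x ih

theorem Shuffle.symm {w w' : List (Σ v, G v)} (h : Shuffle Γ w w') : Shuffle Γ w' w := by
  induction h with
  | nil => exact .nil
  | cons x _ ih => exact .cons x ih
  | swap x y w hxy => exact .swap y x w hxy.symm
  | trans _ _ ih₁ ih₂ => exact ih₂.trans ih₁

theorem Shuffle.append_left (u : List (Σ v, G v)) {w w' : List (Σ v, G v)} (h : Shuffle Γ w w') :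
    Shuffle Γ (u ++ w) (u ++ w') := by
  induction u with
  | nil => exact h
  | cons x u ih => exact .cons x ih

theorem Shuffle.append_right {w w' : List (Σ v, G v)} (h : Shuffle Γ w w')
    (u : List (Σ v, G v)) : Shuffle Γ (w ++ u) (w' ++ u) := by
  induction h with
  | nil => exact .refl u
  | cons x _ ih => exact .cons x ih
  | swap x y w hxy => exact .swap x y _ hxy
  | trans _ _ ih₁ ih₂ => exact ih₁.trans ih₂

theorem Shuffle.perm {w w' : List (Σ v, G v)} (h : Shuffle Γ w w') : w.Perm w' := by
  induction h with
  | nil => exact .nil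
  | cons x _ ih => exact .cons x ih
  | swap x y w _ => exact .swap y x w
  | trans _ _ ih₁ ih₂ => exact ih₁.trans ih₂

/-- A letter moves through a word of letters from adjacent vertex groups. -/
theorem Shuffle.cons_append {x : Σ v, G v} {u : List (Σ v, G v)} (hu : ∀ y ∈ u, Γ.Adj x.1 y.1)
    (w : List (Σ v, G v)) : Shuffle Γ (x :: (u ++ w)) (u ++ x :: w) := by
  induction u with
  | nil => exact .refl _
  | cons y u ih =>
    exact (Shuffle.swap x y _ (hu y (by simp))).trans
      (.cons y (ih fun z hz => hu z (by simp [hz])))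

theorem Shuffle.frontFree_iff {w w' : List (Σ v, G v)} (h : Shuffle Γ w w') (v : V) :
    FrontFree Γ v w ↔ FrontFree Γ v w' := by
  induction h with
  | nil => exact Iff.rfl
  | cons x _ ih => simp only [frontFree_cons, ih]
  | swap x y w hxy =>
    simp only [frontFree_cons]
    by_cases hx : x.1 = v
    · have : Γ.Adj v y.1 := hx ▸ hxy
      tauto
    by_cases hy : y.1 = v
    · have : Γ.Adj v x.1 := hy ▸ hxy.symm
      tauto
    tauto
  | trans _ _ ih₁ ih₂ => exact ih₁.trans ih₂

/-- A letter of `w` not adjacent to `v` shields the front from everything appended behind it. -/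
theorem FrontFree.append {v : V} {w : List (Σ v, G v)} (hw : FrontFree Γ v w)
    (hblock : ¬ ∀ x ∈ w, Γ.Adj v x.1) (u : List (Σ v, G v)) : FrontFree Γ v (w ++ u) := by
  induction w with
  | nil => simp at hblock
  | cons x w ih =>
    refine ⟨hw.1, fun hx => ih (hw.2 hx) fun hall => hblock ?_⟩
    simpa [hx] using hall

theorem FrontFree.of_append {v : V} {w u : List (Σ v, G v)} (hw : FrontFree Γ v (w ++ u)) :
    FrontFree Γ v w := by
  induction w with
  | nil => trivial
  | cons x w ih => exact ⟨hw.1, fun hx => ih (hw.2 hx)⟩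

theorem frontFree_append_cons_iff {v : V} {x y : Σ v, G v} (hxy : x.1 = y.1)
    (P Z : List (Σ v, G v)) :
    FrontFree Γ v (P ++ x :: Z) ↔ FrontFree Γ v (P ++ y :: Z) := by
  induction P with
  | nil => simp [frontFree_cons, hxy]
  | cons z P ih => simp [frontFree_cons, ih]

/-- A word either has no letter of `G v` that can be shuffled to the front, or it has one. -/
theorem frontFree_or_exists_shuffle (v : V) (w : List (Σ v, G v)) :
    FrontFree Γ v w ∨ ∃ (a : G v) (Z : List (Σ v, G v)), Shuffle Γ w (⟨v, a⟩ :: Z) := by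
  induction w with
  | nil => exact .inl trivial
  | cons y w ih =>
    by_cases hy : y.1 = v
    · obtain ⟨u, b⟩ := y
      obtain rfl : u = v := hy
      exact .inr ⟨b, w, .refl _⟩
    by_cases hadj : Γ.Adj v y.1
    · rcases ih with h | ⟨a, Z, h⟩
      · exact .inl ⟨hy, fun _ => h⟩
      · exact .inr ⟨a, y :: Z, (Shuffle.cons y h).trans (.swap y ⟨v, a⟩ Z hadj.symm)⟩
    · exact .inl ⟨hy, fun h => absurd h hadj⟩

variable (Γ) in
/-- `P` keeps all its letters when those that can be shuffled to its end and are adjacent to `v`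
are removed. -/
def EndsBlocked (v : V) : List (Σ v, G v) → Prop
  | [] => True
  | x :: P => EndsBlocked v P ∧ ¬ (Γ.Adj x.1 v ∧ ∀ y ∈ P, Γ.Adj x.1 y.1)

/-- Sort the letters from right to left: a letter goes to `U` exactly when it is adjacent to `v` and
commutes past the letters kept in `P` so far. -/
theorem EndsBlocked.exists_split (v : V) (w : List (Σ v, G v)) :
    ∃ P U : List (Σ v, G v), EndsBlocked Γ v P ∧ (∀ x ∈ U, Γ.Adj v x.1) ∧
      Shuffle Γ w (P ++ U) := by
  induction w with
  | nil => exact ⟨[], [], trivial, by simp, .nil⟩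
  | cons x w ih =>
    obtain ⟨P, U, hP, hU, hw⟩ := ih
    by_cases hx : Γ.Adj x.1 v ∧ ∀ y ∈ P, Γ.Adj x.1 y.1
    · refine ⟨P, x :: U, hP, ?_, (Shuffle.cons x hw).trans (.cons_append hx.2 U)⟩
      simpa [hx.1.symm] using hU
    · exact ⟨x :: P, U, ⟨hP, hx⟩, hU, .cons x hw⟩

/-- If `P` is blocked at the end by `v` and `Q` by a vertex `u` not adjacent to `v`, then `P`
followed by a letter of `G v` and `Q` is blocked at the end by `u`. -/
theorem EndsBlocked.append {v u : V} {P Q : List (Σ v, G v)} (hP : EndsBlocked Γ v P)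
    (hQ : EndsBlocked Γ u Q) (hvu : ¬ Γ.Adj v u) (a : G v) :
    EndsBlocked Γ u (P ++ ⟨v, a⟩ :: Q) := by
  induction P with
  | nil => exact ⟨hQ, fun h => hvu h.1⟩
  | cons x P ih =>
    refine ⟨ih hP.1, fun h => hP.2 ⟨h.2 ⟨v, a⟩ (by simp), fun y hy => h.2 y (by simp [hy])⟩⟩


/-- Links the recursive condition to the positional definition of reduced words; it yields
`isReduced_cons`, the form used in inductions. -/
theorem frontFree_iff_getElem {v : V} {w : List (Σ v, G v)} :
    FrontFree Γ v w ↔ ∀ (l : ℕ) (hl : l < w.length), w[l].1 = v →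
      ∃ (p : ℕ) (hp : p < l), ¬ Γ.Adj v w[p].1 := by
  induction w with
  | nil => simp
  | cons y w ih =>
    rw [frontFree_cons, ih]
    constructor
    · rintro ⟨h1, h2⟩ l hl hlv
      by_cases hadj : Γ.Adj v y.1
      · cases l with
        | zero => exact absurd hlv h1
        | succ l =>
          obtain ⟨p, hp, h3⟩ := h2 hadj l (by simpa using hl) (by simpa using hlv)
          exact ⟨p + 1, by omega, by simpa using h3⟩
      · cases l with
        | zero => exact absurd hlv h1
        | succ l => exact ⟨0, by omega, by simpa using hadj⟩
    · intro h
      refine ⟨fun h0 => ?_, fun hadj l hl hlv => ?_⟩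
      · obtain ⟨p, hp, -⟩ := h 0 (by simp) h0
        omega
      · obtain ⟨p, hp, h3⟩ := h (l + 1) (by simpa using hl) (by simpa using hlv)
        cases p with
        | zero => exact absurd hadj (by simpa using h3)
        | succ p => exact ⟨p, by omega, by simpa using h3⟩

theorem isReducedVertexWord_iff {w : List (Σ v, G v)} :
    IsReducedVertexWord Γ (w.map Sigma.fst) ↔ ∀ (k l : ℕ) (hkl : k < l) (hl : l < w.length),
      w[k].1 = w[l].1 → ∃ (p : ℕ) (hp : p < l), k < p ∧ ¬ Γ.Adj w[k].1 w[p].1 := by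
  unfold IsReducedVertexWord
  constructor
  · intro h k l hkl hl heq
    obtain ⟨p, h1, h2, h3⟩ := h ⟨k, by simp; omega⟩ ⟨l, by simpa using hl⟩ hkl (by simpa using heq)
    exact ⟨p, h2, h1, by simpa using h3⟩
  · rintro h ⟨k, hk⟩ ⟨l, hl⟩ hkl heq
    simp only [List.length_map] at hk hl
    obtain ⟨p, h1, h2, h3⟩ := h k l hkl hl (by simpa using heq)
    exact ⟨⟨p, by simp; omega⟩, h2, h1, by simpa using h3⟩

end Words

/-! ### Reduced words: recursion, gluing and inversion -/

section Reduced

variable {V : Type*} {Γ : SimpleGraph V} {G : V → Type*} [∀ v, Group (G v)]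

@[simp]
theorem isReduced_nil : IsReduced Γ ([] : List (Σ v, G v)) :=
  ⟨by simp, fun k => by simpa using k.2⟩

theorem isReduced_cons {x : Σ v, G v} {w : List (Σ v, G v)} :
    IsReduced Γ (x :: w) ↔ x.2 ≠ 1 ∧ FrontFree Γ x.1 w ∧ IsReduced Γ w := by
  unfold IsReduced
  rw [isReducedVertexWord_iff, isReducedVertexWord_iff, frontFree_iff_getElem]
  constructor
  · rintro ⟨h1, h2⟩
    refine ⟨h1 x (by simp), fun l hl hlv => ?_, fun y hy => h1 y (by simp [hy]),
      fun k l hkl hl heq => ?_⟩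
    · obtain ⟨p, hp, h3, h4⟩ := h2 0 (l + 1) (by omega) (by simpa using hl) (by simpa using hlv.symm)
      obtain ⟨p, rfl⟩ : ∃ q, p = q + 1 := ⟨p - 1, by omega⟩
      exact ⟨p, by omega, by simpa using h4⟩
    · obtain ⟨p, hp, h3, h4⟩ := h2 (k + 1) (l + 1) (by omega) (by simpa using hl)
        (by simpa using heq)
      obtain ⟨p, rfl⟩ : ∃ q, p = q + 1 := ⟨p - 1, by omega⟩
      exact ⟨p, by omega, by omega, by simpa using h4⟩
  · rintro ⟨h1, h2, h3, h4⟩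
    refine ⟨by simpa [h1] using h3, fun k l hkl hl heq => ?_⟩
    obtain ⟨l, rfl⟩ : ∃ q, l = q + 1 := ⟨l - 1, by omega⟩
    cases k with
    | zero =>
      obtain ⟨p, hp, h5⟩ := h2 l (by simpa using hl) (by simpa using heq.symm)
      exact ⟨p + 1, by omega, by omega, by simpa using h5⟩
    | succ k =>
      obtain ⟨p, hp, h5, h6⟩ := h4 k l (by omega) (by simpa using hl) (by simpa using heq)
      exact ⟨p + 1, by omega, by omega, by simpa using h6⟩

theorem Shuffle.isReduced {w w' : List (Σ v, G v)} (h : Shuffle Γ w w') (hw : IsReduced Γ w) :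
    IsReduced Γ w' := by
  induction h with
  | nil => exact hw
  | cons x h ih =>
    rw [isReduced_cons] at hw ⊢
    exact ⟨hw.1, (h.frontFree_iff _).1 hw.2.1, ih hw.2.2⟩
  | swap x y w hxy =>
    simp only [isReduced_cons, frontFree_cons] at hw ⊢
    have := hxy.symm
    tauto
  | trans _ _ ih₁ ih₂ => exact ih₂ (ih₁ hw)

theorem Shuffle.wordProd_eq {w w' : List (Σ v, G v)} (h : Shuffle Γ w w') :
    wordProd Γ w = wordProd Γ w' := by
  induction h with
  | nil => rfl
  | cons x _ ih => simp [ih]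
  | swap x y w hxy =>
    simp only [wordProd_cons, ← mul_assoc]
    rw [(commute_of Γ hxy x.2 y.2).eq]
  | trans _ _ ih₁ ih₂ => exact ih₁.trans ih₂

theorem IsReduced.of_append {P Z : List (Σ v, G v)} (h : IsReduced Γ (P ++ Z)) :
    IsReduced Γ P := by
  induction P with
  | nil => simp
  | cons x P ih =>
    rw [List.cons_append, isReduced_cons] at h
    exact isReduced_cons.2 ⟨h.1, h.2.1.of_append, ih h.2.2⟩

/-- Words whose last, respectively first, letter lies in `G v` combine to a reduced word, if the
letter blocks all those in front of it. -/
theorem EndsBlocked.isReduced_append {v : V} {P Z : List (Σ v, G v)} (hP : EndsBlocked Γ v P)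
    {a b : G v} (hPa : IsReduced Γ (P ++ [⟨v, a⟩])) (hZ : IsReduced Γ (⟨v, b⟩ :: Z)) :
    IsReduced Γ (P ++ ⟨v, b⟩ :: Z) := by
  induction P with
  | nil => exact hZ
  | cons x P ih =>
    rw [List.cons_append, isReduced_cons] at hPa
    refine isReduced_cons.2 ⟨hPa.1, ?_, ih hP.1 hPa.2.2⟩
    have h1 : FrontFree Γ x.1 (P ++ [⟨v, b⟩]) :=
      (frontFree_append_cons_iff (x := ⟨v, a⟩) (y := ⟨v, b⟩) rfl P []).1 hPa.2.1
    -- If `x` were adjacent to `v` and to all later letters of `P`, it could be shuffled to the end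
    -- of `P`, which `hP` forbids; so the tail `Z` stays invisible to `x`.
    have h2 := h1.append (fun hall => hP.2 ⟨hall ⟨v, b⟩ (by simp),
      fun y hy => hall y (by simp [hy])⟩) Z
    simpa using h2

/-- The formal inverse of a word. -/
def invWord (w : List (Σ v, G v)) : List (Σ v, G v) :=
  (w.map fun x => (⟨x.1, x.2⁻¹⟩ : Σ v, G v)).reverse

theorem invWord_cons (x : Σ v, G v) (w : List (Σ v, G v)) :
    invWord (x :: w) = invWord w ++ [⟨x.1, x.2⁻¹⟩] := by
  simp [invWord]

theorem wordProd_invWord (w : List (Σ v, G v)) : wordProd Γ (invWord w) = (wordProd Γ w)⁻¹ := by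
  induction w with
  | nil => simp [invWord]
  | cons x w ih => simp [invWord_cons, ih]

theorem IsReduced.invWord {w : List (Σ v, G v)} (hw : IsReduced Γ w) :
    IsReduced Γ (invWord w) := by
  have hlen : (GraphProd.invWord w).length = w.length := by simp [GraphProd.invWord]
  have hget : ∀ (k : ℕ) (hk : k < (GraphProd.invWord w).length),
      (GraphProd.invWord w)[k].1 = (w[w.length - 1 - k]'(by omega)).1 := by
    intro k hk
    simp [GraphProd.invWord]
  refine ⟨?_, isReducedVertexWord_iff.2 fun k l hkl hl heq => ?_⟩
  · intro x hx
    simp only [GraphProd.invWord, List.mem_reverse, List.mem_map] at hx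
    obtain ⟨y, hy, rfl⟩ := hx
    simpa using hw.1 y hy
  · rw [hget, hget] at heq
    obtain ⟨p, hp, h1, h2⟩ := isReducedVertexWord_iff.1 hw.2 (w.length - 1 - l)
      (w.length - 1 - k) (by omega) (by omega) heq.symm
    refine ⟨w.length - 1 - p, by omega, by omega, ?_⟩
    rw [hget, hget]
    have hpp : w.length - 1 - (w.length - 1 - p) = p := by omega
    simp only [hpp]
    rwa [heq]

end Reduced

/-! ### Left multiplication on reduced words -/

section NormalForm

variable {V : Type*} (Γ : SimpleGraph V) {G : V → Type*} [∀ v, Group (G v)]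

open Classical in
/-- Multiply a word by a nontrivial letter from the left, merging it with the first letter of the
same vertex group if it can be moved there. -/
noncomputable def insertLetter (x : Σ v, G v) : List (Σ v, G v) → List (Σ v, G v)
  | [] => [x]
  | y :: w =>
    if h : x.1 = y.1 then
      if (h ▸ x.2) * y.2 = 1 then w else ⟨y.1, (h ▸ x.2) * y.2⟩ :: w
    else if Γ.Adj x.1 y.1 then y :: insertLetter x w else x :: y :: w

open Classical in
/-- The action of a letter on words. -/
noncomputable def letterMul (x : Σ v, G v) (w : List (Σ v, G v)) : List (Σ v, G v) :=
  if x.2 = 1 then w else insertLetter Γ x w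

variable {Γ}

@[simp]
theorem insertLetter_nil (x : Σ v, G v) : insertLetter Γ x [] = [x] := rfl

theorem insertLetter_same_of_eq {v : V} {g a : G v} (w : List (Σ v, G v)) (h : g * a = 1) :
    insertLetter Γ ⟨v, g⟩ (⟨v, a⟩ :: w) = w := by
  simp [insertLetter, h]

theorem insertLetter_same_of_ne {v : V} {g a : G v} (w : List (Σ v, G v)) (h : g * a ≠ 1) :
    insertLetter Γ ⟨v, g⟩ (⟨v, a⟩ :: w) = ⟨v, g * a⟩ :: w := by
  simp [insertLetter, h]

theorem insertLetter_adj {x y : Σ v, G v} (w : List (Σ v, G v)) (h : Γ.Adj x.1 y.1) :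
    insertLetter Γ x (y :: w) = y :: insertLetter Γ x w := by
  simp [insertLetter, h, h.ne]

theorem insertLetter_blocked {x y : Σ v, G v} (w : List (Σ v, G v)) (hne : x.1 ≠ y.1)
    (h : ¬ Γ.Adj x.1 y.1) : insertLetter Γ x (y :: w) = x :: y :: w := by
  simp [insertLetter, h, hne]

theorem insertLetter_induction (x : Σ v, G v) {motive : List (Σ v, G v) → Prop}
    (nil : motive [])
    (cancel : ∀ (a : G x.1) (w : List (Σ v, G v)), x.2 * a = 1 → motive (⟨x.1, a⟩ :: w))
    (merge : ∀ (a : G x.1) (w : List (Σ v, G v)), x.2 * a ≠ 1 → motive (⟨x.1, a⟩ :: w))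
    (adj : ∀ (y : Σ v, G v) (w : List (Σ v, G v)), Γ.Adj x.1 y.1 → motive w → motive (y :: w))
    (blocked : ∀ (y : Σ v, G v) (w : List (Σ v, G v)), x.1 ≠ y.1 → ¬ Γ.Adj x.1 y.1 →
      motive (y :: w)) (w : List (Σ v, G v)) : motive w := by
  induction w with
  | nil => exact nil
  | cons y w ih =>
    by_cases hxy : x.1 = y.1
    · obtain ⟨v, g⟩ := x
      obtain ⟨u, a⟩ := y
      obtain rfl : v = u := hxy
      by_cases h : g * a = 1
      · exact cancel a w h
      · exact merge a w h
    · by_cases hadj : Γ.Adj x.1 y.1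
      · exact adj y w hadj ih
      · exact blocked y w hxy hadj

theorem wordProd_insertLetter (x : Σ v, G v) (w : List (Σ v, G v)) :
    wordProd Γ (insertLetter Γ x w) = of Γ x.1 x.2 * wordProd Γ w := by
  induction w using insertLetter_induction (Γ := Γ) x with
  | nil => simp
  | cancel a w h =>
    rw [insertLetter_same_of_eq w h, wordProd_cons, ← mul_assoc, ← map_mul, h, map_one, one_mul]
  | merge a w h =>
    rw [insertLetter_same_of_ne w h, wordProd_cons, wordProd_cons, ← mul_assoc, ← map_mul]
  | adj y w h ih =>
    rw [insertLetter_adj w h, wordProd_cons, wordProd_cons, ih, ← mul_assoc, ← mul_assoc,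
      (commute_of Γ h x.2 y.2).eq]
  | blocked y w h h' => rw [insertLetter_blocked w h h', wordProd_cons]

theorem length_insertLetter_le (x : Σ v, G v) (w : List (Σ v, G v)) :
    (insertLetter Γ x w).length ≤ w.length + 1 := by
  induction w using insertLetter_induction (Γ := Γ) x with
  | nil => simp
  | cancel a w h => rw [insertLetter_same_of_eq w h]; simp; omega
  | merge a w h => rw [insertLetter_same_of_ne w h]; simp
  | adj y w h ih => rw [insertLetter_adj w h]; simpa using ih
  | blocked y w h h' => rw [insertLetter_blocked w h h']; simp

theorem forall_mem_insertLetter {p : V → Prop} {x : Σ v, G v} (hx : p x.1)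
    {w : List (Σ v, G v)} (hw : ∀ y ∈ w, p y.1) : ∀ y ∈ insertLetter Γ x w, p y.1 := by
  induction w using insertLetter_induction (Γ := Γ) x with
  | nil => simpa using hx
  | cancel a w h =>
    rw [insertLetter_same_of_eq w h]
    exact fun y hy => hw y (by simp [hy])
  | merge a w h =>
    rw [insertLetter_same_of_ne w h]
    simp only [List.forall_mem_cons] at hw ⊢
    exact hw
  | adj y w h ih =>
    rw [insertLetter_adj w h]
    simp only [List.forall_mem_cons] at hw ⊢
    exact ⟨hw.1, ih hw.2⟩
  | blocked y w h h' =>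
    rw [insertLetter_blocked w h h']
    simp only [List.forall_mem_cons] at hw ⊢
    exact ⟨hx, hw⟩

theorem FrontFree.insertLetter {v : V} {x : Σ v, G v} (hx : Γ.Adj v x.1) {w : List (Σ v, G v)}
    (hw : FrontFree Γ v w) : FrontFree Γ v (insertLetter Γ x w) := by
  induction w using insertLetter_induction (Γ := Γ) x with
  | nil => exact ⟨hx.ne', fun _ => trivial⟩
  | cancel a w h => rw [insertLetter_same_of_eq w h]; exact hw.2 hx
  | merge a w h => rw [insertLetter_same_of_ne w h]; exact hw
  | adj y w h ih => rw [insertLetter_adj w h]; exact ⟨hw.1, fun hy => ih (hw.2 hy)⟩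
  | blocked y w h h' => rw [insertLetter_blocked w h h']; exact ⟨hx.ne', fun _ => hw⟩

theorem IsReduced.insertLetter {x : Σ v, G v} (hx : x.2 ≠ 1) {w : List (Σ v, G v)}
    (hw : IsReduced Γ w) : IsReduced Γ (insertLetter Γ x w) := by
  induction w using insertLetter_induction (Γ := Γ) x with
  | nil => exact isReduced_cons.2 ⟨hx, trivial, isReduced_nil⟩
  | cancel a w h => rw [insertLetter_same_of_eq w h]; exact (isReduced_cons.1 hw).2.2
  | merge a w h =>
    rw [insertLetter_same_of_ne w h]
    exact isReduced_cons.2 ⟨h, (isReduced_cons.1 hw).2⟩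
  | adj y w h ih =>
    rw [insertLetter_adj w h]
    rw [isReduced_cons] at hw
    exact isReduced_cons.2 ⟨hw.1, hw.2.1.insertLetter h.symm, ih hw.2.2⟩
  | blocked y w h h' =>
    rw [insertLetter_blocked w h h']
    exact isReduced_cons.2 ⟨hx, ⟨h.symm, fun h2 => absurd h2 h'⟩, hw⟩

/-- With nothing to merge with, the inserted letter only travels past adjacent letters, which a
shuffle undoes. -/
theorem FrontFree.shuffle_insertLetter {x : Σ v, G v} {w : List (Σ v, G v)}
    (hw : FrontFree Γ x.1 w) : Shuffle Γ (GraphProd.insertLetter Γ x w) (x :: w) := by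
  induction w using insertLetter_induction (Γ := Γ) x with
  | nil => exact .refl _
  | cancel a w h => exact absurd rfl hw.1
  | merge a w h => exact absurd rfl hw.1
  | adj y w h ih =>
    rw [insertLetter_adj w h]
    exact (Shuffle.cons y (ih (hw.2 h))).trans (.swap y x w h.symm)
  | blocked y w h h' => rw [insertLetter_blocked w h h']; exact .refl _

/-- Makes insertion descend to shuffle classes. In a swap of `y` and `z` with `x` in the group of
`y`, the letter `x` also passes `z`, so it meets `y` in either order. -/
theorem Shuffle.insertLetter {w w' : List (Σ v, G v)} (h : Shuffle Γ w w') (x : Σ v, G v) :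
    Shuffle Γ (insertLetter Γ x w) (insertLetter Γ x w') := by
  have key : ∀ (y z : Σ v, G v) (w : List (Σ v, G v)), Γ.Adj y.1 z.1 → x.1 = y.1 →
      Shuffle Γ (GraphProd.insertLetter Γ x (y :: z :: w))
        (GraphProd.insertLetter Γ x (z :: y :: w)) := by
    rintro ⟨u, a⟩ z w hyz hxy
    obtain ⟨v, g⟩ := x
    obtain rfl : v = u := hxy
    rw [insertLetter_adj (x := ⟨v, g⟩) (y := z) _ hyz]
    by_cases hga : g * a = 1
    · rw [insertLetter_same_of_eq _ hga, insertLetter_same_of_eq _ hga]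
      exact .refl _
    · rw [insertLetter_same_of_ne _ hga, insertLetter_same_of_ne _ hga]
      exact .swap _ _ _ hyz
  induction h with
  | nil => exact .refl _
  | @cons y w w' h ih =>
    by_cases hxy : x.1 = y.1
    · obtain ⟨v, g⟩ := x
      obtain ⟨u, a⟩ := y
      obtain rfl : v = u := hxy
      by_cases hga : g * a = 1
      · rwa [insertLetter_same_of_eq _ hga, insertLetter_same_of_eq _ hga]
      · rw [insertLetter_same_of_ne _ hga, insertLetter_same_of_ne _ hga]
        exact .cons _ h
    · by_cases hadj : Γ.Adj x.1 y.1
      · rw [insertLetter_adj _ hadj, insertLetter_adj _ hadj]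
        exact .cons _ ih
      · rw [insertLetter_blocked _ hxy hadj, insertLetter_blocked _ hxy hadj]
        exact .cons _ (.cons _ h)
  | swap y z w hyz =>
    by_cases hxy : x.1 = y.1
    · exact key y z w hyz hxy
    by_cases hxz : x.1 = z.1
    · exact (key z y w hyz.symm hxz).symm
    by_cases hy : Γ.Adj x.1 y.1
    · by_cases hz : Γ.Adj x.1 z.1
      · simp only [insertLetter_adj _ hy, insertLetter_adj _ hz]
        exact .swap _ _ _ hyz
      · rw [insertLetter_adj _ hy, insertLetter_blocked _ hxz hz, insertLetter_blocked _ hxz hz]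
        exact (Shuffle.swap y x _ hy.symm).trans (.cons x (.swap y z w hyz))
    · by_cases hz : Γ.Adj x.1 z.1
      · rw [insertLetter_adj _ hz, insertLetter_blocked _ hxy hy, insertLetter_blocked _ hxy hy]
        exact (Shuffle.cons x (.swap y z w hyz)).trans (.swap x z _ hz)
      · rw [insertLetter_blocked _ hxy hy, insertLetter_blocked _ hxz hz]
        exact .cons x (.swap y z w hyz)
  | trans _ _ ih₁ ih₂ => exact ih₁.trans ih₂

/-- Multiplicativity of the action of one vertex group. Reducedness enters where `k` meets a letter
`a`: `a` is nontrivial, and if it cancels, the rest offers `g` no further letter of `G v` to merge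
with. -/
theorem shuffle_insertLetter_insertLetter {v : V} {g k : G v} (hg : g ≠ 1)
    {w : List (Σ v, G v)} (hw : IsReduced Γ w) :
    Shuffle Γ (insertLetter Γ ⟨v, g⟩ (insertLetter Γ ⟨v, k⟩ w)) (letterMul Γ ⟨v, g * k⟩ w) := by
  classical
  have hsame : ∀ w : List (Σ v, G v),
      Shuffle Γ (insertLetter Γ ⟨v, g⟩ (⟨v, k⟩ :: w))
        (if g * k = 1 then w else ⟨v, g * k⟩ :: w) := by
    intro w
    split_ifs with h
    · rw [insertLetter_same_of_eq _ h]; exact .refl _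
    · rw [insertLetter_same_of_ne _ h]; exact .refl _
  unfold letterMul
  induction w using insertLetter_induction (Γ := Γ) ⟨v, k⟩ with
  | nil => simpa using hsame []
  | cancel a w h =>
    rw [insertLetter_same_of_eq w h]
    change k * a = 1 at h
    have hw' : Shuffle Γ (insertLetter Γ ⟨v, g⟩ w) (⟨v, g⟩ :: w) :=
      FrontFree.shuffle_insertLetter (x := ⟨v, g⟩) (isReduced_cons.1 hw).2.1
    have hgka : g * k * a = g := by rw [mul_assoc, h, mul_one]
    split_ifs with h1
    · have hga : g = a := by simpa [show g * k = 1 from h1] using hgka.symm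
      subst hga
      exact hw'
    · rw [insertLetter_same_of_ne w (by rwa [hgka]), hgka]
      exact hw'
  | merge a w h =>
    rw [insertLetter_same_of_ne w h]
    change k * a ≠ 1 at h
    split_ifs with h1
    · have hgka : g * (k * a) = a := by rw [← mul_assoc, show g * k = 1 from h1, one_mul]
      rw [insertLetter_same_of_ne w (by rw [hgka]; exact (isReduced_cons.1 hw).1)]
      simp only [hgka]
      exact .refl _
    · by_cases h2 : g * k * a = 1
      · rw [insertLetter_same_of_eq w h2, insertLetter_same_of_eq w (by rwa [← mul_assoc])]
        exact .refl _
      · rw [insertLetter_same_of_ne w h2, insertLetter_same_of_ne w (by rwa [← mul_assoc]),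
          mul_assoc]
        exact .refl _
  | adj y w h ih =>
    rw [insertLetter_adj (x := ⟨v, k⟩) w h, insertLetter_adj (x := ⟨v, g⟩) _ h]
    rw [insertLetter_adj (x := ⟨v, g * k⟩) _ h]
    have := Shuffle.cons y (ih (isReduced_cons.1 hw).2.2)
    split_ifs at this ⊢ <;> exact this
  | blocked y w h h' =>
    rw [insertLetter_blocked (x := ⟨v, k⟩) w h h', insertLetter_blocked (x := ⟨v, g * k⟩) _ h h']
    exact hsame _

/-- The defining relations of the graph product hold for the action on shuffle classes. -/
theorem shuffle_insertLetter_comm {x y : Σ v, G v} (hxy : Γ.Adj x.1 y.1)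
    (w : List (Σ v, G v)) : Shuffle Γ (insertLetter Γ x (insertLetter Γ y w))
      (insertLetter Γ y (insertLetter Γ x w)) := by
  have key : ∀ (x y z : Σ v, G v) (w : List (Σ v, G v)), Γ.Adj x.1 y.1 → x.1 = z.1 →
      insertLetter Γ x (insertLetter Γ y (z :: w)) =
        insertLetter Γ y (insertLetter Γ x (z :: w)) := by
    rintro ⟨v, g⟩ y ⟨u, a⟩ w hxy hxz
    obtain rfl : v = u := hxz
    rw [insertLetter_adj (x := y) (y := ⟨v, a⟩) _ hxy.symm]
    by_cases hga : g * a = 1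
    · rw [insertLetter_same_of_eq _ hga, insertLetter_same_of_eq _ hga]
    · rw [insertLetter_same_of_ne _ hga, insertLetter_same_of_ne _ hga]
      rw [insertLetter_adj (x := y) (y := ⟨v, g * a⟩) _ hxy.symm]
  induction w with
  | nil =>
    rw [insertLetter_nil, insertLetter_nil, insertLetter_adj _ hxy, insertLetter_adj _ hxy.symm]
    exact .swap _ _ _ hxy.symm
  | cons z w ih =>
    by_cases hxz : x.1 = z.1
    · rw [key x y z w hxy hxz]; exact .refl _
    by_cases hyz : y.1 = z.1
    · rw [key y x z w hxy.symm hyz]; exact .refl _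
    by_cases hx : Γ.Adj x.1 z.1
    · by_cases hy : Γ.Adj y.1 z.1
      · simp only [insertLetter_adj _ hx, insertLetter_adj _ hy]
        exact .cons _ ih
      · rw [insertLetter_adj _ hx, insertLetter_blocked _ hyz hy, insertLetter_blocked _ hyz hy,
          insertLetter_adj _ hxy, insertLetter_adj _ hx]
        exact .refl _
    · by_cases hy : Γ.Adj y.1 z.1
      · rw [insertLetter_adj _ hy, insertLetter_blocked _ hxz hx, insertLetter_blocked _ hxz hx,
          insertLetter_adj _ hxy.symm, insertLetter_adj _ hy]
        exact .refl _
      · rw [insertLetter_blocked _ hyz hy, insertLetter_blocked _ hxz hx,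
          insertLetter_adj _ hxy, insertLetter_adj _ hxy.symm, insertLetter_blocked _ hxz hx,
          insertLetter_blocked _ hyz hy]
        exact .swap _ _ _ hxy.symm

theorem letterMul_one (v : V) (w : List (Σ v, G v)) : letterMul Γ ⟨v, 1⟩ w = w := if_pos rfl

theorem wordProd_letterMul (x : Σ v, G v) (w : List (Σ v, G v)) :
    wordProd Γ (letterMul Γ x w) = of Γ x.1 x.2 * wordProd Γ w := by
  unfold letterMul
  split_ifs with h
  · simp [h]
  · exact wordProd_insertLetter x w

theorem IsReduced.letterMul (x : Σ v, G v) {w : List (Σ v, G v)} (hw : IsReduced Γ w) :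
    IsReduced Γ (letterMul Γ x w) := by
  unfold GraphProd.letterMul
  split_ifs with h
  · exact hw
  · exact hw.insertLetter h

theorem FrontFree.letterMul {v : V} {x : Σ v, G v} (hx : Γ.Adj v x.1) {w : List (Σ v, G v)}
    (hw : FrontFree Γ v w) : FrontFree Γ v (letterMul Γ x w) := by
  unfold GraphProd.letterMul
  split_ifs with h
  · exact hw
  · exact hw.insertLetter hx

theorem Shuffle.letterMul {w w' : List (Σ v, G v)} (h : Shuffle Γ w w') (x : Σ v, G v) :
    Shuffle Γ (letterMul Γ x w) (letterMul Γ x w') := by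
  unfold GraphProd.letterMul
  split_ifs
  · exact h
  · exact h.insertLetter x

theorem shuffle_letterMul_letterMul {v : V} (g k : G v) {w : List (Σ v, G v)}
    (hw : IsReduced Γ w) :
    Shuffle Γ (letterMul Γ ⟨v, g⟩ (letterMul Γ ⟨v, k⟩ w)) (letterMul Γ ⟨v, g * k⟩ w) := by
  by_cases hg : g = 1
  · subst hg
    rw [one_mul, letterMul_one]
    exact .refl _
  by_cases hk : k = 1
  · subst hk
    rw [mul_one, letterMul_one]
    exact .refl _
  have := shuffle_insertLetter_insertLetter (k := k) hg hw
  rw [letterMul, if_neg hg, letterMul, if_neg hk]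
  exact this

theorem shuffle_letterMul_comm {x y : Σ v, G v} (hxy : Γ.Adj x.1 y.1)
    (w : List (Σ v, G v)) : Shuffle Γ (letterMul Γ x (letterMul Γ y w))
      (letterMul Γ y (letterMul Γ x w)) := by
  unfold letterMul
  split_ifs
  · exact .refl _
  · exact .refl _
  · exact .refl _
  · exact shuffle_insertLetter_comm hxy w

/-! ### Normal form theorem via the action on shuffle classes -/

variable (Γ G) in
/-- Reduced words up to shuffling. -/
def reducedWordSetoid : Setoid {w : List (Σ v, G v) // IsReduced Γ w} where
  r w w' := Shuffle Γ w.1 w'.1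
  iseqv := ⟨fun w => .refl w.1, fun h => h.symm, fun h h' => h.trans h'⟩

variable (Γ G) in
/-- The set of shuffle classes of reduced words. -/
abbrev ReducedClass : Type _ := Quotient (reducedWordSetoid Γ G)

/-- The action of a vertex group on shuffle classes of reduced words. -/
noncomputable def vertexAction (v : V) : G v →* Function.End (ReducedClass Γ G) where
  toFun g := Quotient.map' (fun w => ⟨letterMul Γ ⟨v, g⟩ w.1, w.2.letterMul _⟩)
    fun _ _ h => Shuffle.letterMul h ⟨v, g⟩
  map_one' := by
    funext c
    induction c using Quotient.inductionOn' with
    | h w =>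
      refine Quotient.sound' ?_
      change Shuffle Γ (letterMul Γ ⟨v, 1⟩ w.1) w.1
      rw [letterMul_one]
      exact .refl _
  map_mul' g k := by
    funext c
    induction c using Quotient.inductionOn' with
    | h w => exact Quotient.sound' (shuffle_letterMul_letterMul g k w.2).symm

/-- The action of the graph product on shuffle classes of reduced words. -/
noncomputable def reducedClassAction :
    GraphProduct Γ G →* Equiv.Perm (ReducedClass Γ G) :=
  lift Γ (fun v => (vertexAction v).toHomPerm) (by
    intro v u hvu g k
    ext c
    induction c using Quotient.inductionOn' with
    | h w => exact Quotient.sound' (shuffle_letterMul_comm (x := ⟨v, g⟩) (y := ⟨u, k⟩) hvu w.1))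

/-- Each letter of a reduced word is nontrivial and finds nothing to merge with in the part already
built, so acting by it just prepends it. Hence the element determines the class of the word. -/
theorem reducedClassAction_wordProd {w : List (Σ v, G v)} (hw : IsReduced Γ w) :
    reducedClassAction (wordProd Γ w) (Quotient.mk'' ⟨[], isReduced_nil⟩) =
      (Quotient.mk'' ⟨w, hw⟩ : ReducedClass Γ G) := by
  induction w with
  | nil => simp
  | cons x w ih =>
    have hw' := isReduced_cons.1 hw
    rw [wordProd_cons, map_mul, Equiv.Perm.mul_apply, ih hw'.2.2]
    have : reducedClassAction (of Γ x.1 x.2) = (vertexAction (Γ := Γ) x.1).toHomPerm x.2 :=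
      lift_of Γ _ _ x.1 x.2
    rw [this]
    refine Quotient.sound' ?_
    change Shuffle Γ (letterMul Γ ⟨x.1, x.2⟩ w) (x :: w)
    rw [letterMul, if_neg hw'.1]
    exact hw'.2.1.shuffle_insertLetter

/-- The normal form theorem for graph products: reduced words with the same product agree up to
shuffling. -/
theorem shuffle_of_wordProd_eq {w w' : List (Σ v, G v)} (hw : IsReduced Γ w)
    (hw' : IsReduced Γ w') (h : wordProd Γ w = wordProd Γ w') : Shuffle Γ w w' := by
  have h1 := reducedClassAction_wordProd hw
  rw [h, reducedClassAction_wordProd hw'] at h1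
  exact (Quotient.exact' h1).symm

/-- Every word can be reduced without increasing its length or its set of vertices. -/
theorem exists_isReduced_of_word (w : List (Σ v, G v)) :
    ∃ w' : List (Σ v, G v), IsReduced Γ w' ∧ wordProd Γ w' = wordProd Γ w ∧
      w'.length ≤ w.length ∧ ∀ p : V → Prop, (∀ x ∈ w, p x.1) → ∀ x ∈ w', p x.1 := by
  induction w with
  | nil => exact ⟨[], by simp, rfl, le_rfl, fun p h => h⟩
  | cons x w ih =>
    obtain ⟨w', h1, h2, h3, h4⟩ := ih
    refine ⟨letterMul Γ x w', h1.letterMul x, by rw [wordProd_letterMul, h2, wordProd_cons],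
      ?_, fun p hp => ?_⟩
    · unfold letterMul
      split_ifs
      · simp; omega
      · have := length_insertLetter_le (Γ := Γ) x w'
        simp; omega
    · simp only [List.forall_mem_cons] at hp
      unfold letterMul
      split_ifs
      · exact h4 p hp.2
      · exact forall_mem_insertLetter hp.1 (h4 p hp.2)

/-! ### Elements with no `G v` letter in front -/

variable (Γ) in
/-- Elements of the graph product with a reduced expression in which no letter of `G v` can be
moved to the front. -/
def HasFrontFree (v : V) (m : GraphProduct Γ G) : Prop :=
  ∃ w : List (Σ v, G v), IsReduced Γ w ∧ FrontFree Γ v w ∧ wordProd Γ w = m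

theorem hasFrontFree_one (v : V) : HasFrontFree Γ v (1 : GraphProduct Γ G) :=
  ⟨[], by simp, by simp, rfl⟩

theorem HasFrontFree.wordProd_mul {v : V} {m : GraphProduct Γ G} (hm : HasFrontFree Γ v m)
    {u : List (Σ v, G v)} (hu : ∀ x ∈ u, Γ.Adj v x.1) : HasFrontFree Γ v (wordProd Γ u * m) := by
  induction u with
  | nil => simpa using hm
  | cons x u ih =>
    obtain ⟨w, h1, h2, h3⟩ := ih fun y hy => hu y (by simp [hy])
    refine ⟨letterMul Γ x w, h1.letterMul x, h2.letterMul (hu x (by simp)), ?_⟩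
    rw [wordProd_letterMul, h3, wordProd_cons, mul_assoc]

theorem HasFrontFree.wordProd_inv_mul {v : V} {m : GraphProduct Γ G} (hm : HasFrontFree Γ v m)
    {u : List (Σ v, G v)} (hu : ∀ x ∈ u, Γ.Adj v x.1) :
    HasFrontFree Γ v ((wordProd Γ u)⁻¹ * m) := by
  rw [← wordProd_invWord]
  refine hm.wordProd_mul fun x hx => ?_
  simp only [invWord, List.mem_reverse, List.mem_map] at hx
  obtain ⟨y, hy, rfl⟩ := hx
  exact hu y hy

/-- The `G v` component is a letter that can be shuffled to the front of a reduced word, or `1` if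
there is none. -/
theorem exists_of_mul_hasFrontFree (v : V) (m : GraphProduct Γ G) :
    ∃ (a : G v) (z : GraphProduct Γ G), HasFrontFree Γ v z ∧ m = of Γ v a * z := by
  obtain ⟨w, hw, rfl⟩ := exists_isReduced Γ m
  rcases frontFree_or_exists_shuffle v w with h | ⟨a, Z, h⟩
  · exact ⟨1, wordProd Γ w, ⟨w, hw, h, rfl⟩, by simp⟩
  · have h' := isReduced_cons.1 (h.isReduced hw)
    exact ⟨a, wordProd Γ Z, ⟨Z, h'.2.2, h'.2.1, rfl⟩, by rw [h.wordProd_eq, wordProd_cons]⟩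

end NormalForm

/-! ### Positive matrices over the algebra -/

section Schur

theorem exists_eq_star_mul_self {B : Type*} [NonUnitalCStarAlgebra B] [PartialOrder B]
    [StarOrderedRing B] {b : B} (hb : 0 ≤ b) : ∃ c, b = star c * c :=
  CStarAlgebra.nonneg_iff_eq_star_mul_self.1 hb

variable {A : Type*} [CStarAlgebra A] [PartialOrder A] [StarOrderedRing A] {n : Type*} [Fintype n]

/-- The Schur product of two positive matrices is positive if one has central entries. -/
theorem nonneg_hadamard_of_mem_center [DecidableEq n] {M N : CStarMatrix n n A} (hM : 0 ≤ M)
    (hN : 0 ≤ N) (hc : ∀ i j, M i j ∈ Set.center A) :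
    0 ≤ (CStarMatrix.ofMatrix (Matrix.of fun i j => M i j * N i j) : CStarMatrix n n A) := by
  obtain ⟨C, rfl⟩ := exists_eq_star_mul_self hN
  -- With `N = C* C` and `D_k` the diagonal matrix of the `k`-th row of `C`, the Schur product is `∑
  -- D_k* M D_k`: centrality moves `M i j` past `star (C k i)`.
  have key : (CStarMatrix.ofMatrix (Matrix.of fun i j => M i j * (star C * C) i j) :
      CStarMatrix n n A) = ∑ k, star (CStarMatrix.ofMatrix (Matrix.diagonal (C k))) * M *
        CStarMatrix.ofMatrix (Matrix.diagonal (C k)) := by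
    ext i j
    have hsum : ∀ (f : n → CStarMatrix n n A), (∑ k, f k) i j = ∑ k, f k i j := fun f =>
      Matrix.sum_apply i j _ f
    have hterm : ∀ k, (star (CStarMatrix.ofMatrix (Matrix.diagonal (C k))) * M *
        CStarMatrix.ofMatrix (Matrix.diagonal (C k)) : CStarMatrix n n A) i j =
          star (C k i) * M i j * C k j := by
      intro k
      rw [CStarMatrix.mul_apply, Finset.sum_eq_single j, CStarMatrix.mul_apply,
        Finset.sum_eq_single i]
      · simp [CStarMatrix.star_apply, CStarMatrix.ofMatrix_apply]
      · intro l _ hl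
        simp [CStarMatrix.star_apply, CStarMatrix.ofMatrix_apply, Matrix.diagonal_apply_ne _ hl]
      · simp
      · intro l _ hl
        simp [CStarMatrix.ofMatrix_apply, Matrix.diagonal_apply_ne _ hl]
      · simp
    rw [hsum]
    simp only [hterm]
    change M i j * (star C * C) i j = _
    rw [CStarMatrix.mul_apply, Finset.mul_sum]
    refine Finset.sum_congr rfl fun k _ => ?_
    rw [CStarMatrix.star_apply, ← mul_assoc, Semigroup.mem_center_iff.1 (hc i j)]
  rw [key]
  exact Finset.sum_nonneg fun k _ => star_left_conjugate_nonneg hM _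

theorem nonneg_map_starAlgEquiv (e : A ≃⋆ₐ[ℂ] A) {M : CStarMatrix n n A} (hM : 0 ≤ M) :
    0 ≤ (CStarMatrix.ofMatrix (Matrix.of fun i j => e (M i j)) : CStarMatrix n n A) := by
  obtain ⟨C, rfl⟩ := exists_eq_star_mul_self hM
  have key : (CStarMatrix.ofMatrix (Matrix.of fun i j => e ((star C * C) i j)) :
      CStarMatrix n n A) = star (C.map e) * C.map e := by
    ext i j
    change e ((star C * C) i j) = _
    simp [CStarMatrix.mul_apply, CStarMatrix.star_apply, map_sum, map_mul, map_star]
  rw [key]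
  exact star_mul_self_nonneg _

theorem nonneg_one_entries (n : ℕ) :
    0 ≤ (CStarMatrix.ofMatrix (Matrix.of fun _ _ => 1) : CStarMatrix (Fin n) (Fin n) A) := by
  cases n with
  | zero => exact le_of_eq (CStarMatrix.ext fun i => i.elim0)
  | succ n =>
    -- A single row of ones; the index `0` exists only for nonempty size, hence the separate case `n
    -- = 0`.
    let C : CStarMatrix (Fin (n + 1)) (Fin (n + 1)) A :=
      CStarMatrix.ofMatrix (Matrix.of fun i _ => if i = 0 then 1 else 0)
    have key : (CStarMatrix.ofMatrix (Matrix.of fun _ _ => 1) :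
        CStarMatrix (Fin (n + 1)) (Fin (n + 1)) A) = star C * C := by
      ext i j
      rw [CStarMatrix.mul_apply, Finset.sum_eq_single 0]
      · simp [C, CStarMatrix.star_apply, CStarMatrix.ofMatrix_apply]
      · intro k _ hk
        simp [C, CStarMatrix.star_apply, CStarMatrix.ofMatrix_apply, hk]
      · simp
    rw [key]
    exact star_mul_self_nonneg _

end Schur

/-! ### Length and the choice of an outermost coset -/

section Length

variable {V : Type*} (Γ : SimpleGraph V) {G : V → Type*} [∀ v, Group (G v)]

/-- The number of letters of a reduced expression. -/
noncomputable def wordLength (s : GraphProduct Γ G) : ℕ := (exists_isReduced Γ s).choose.length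

variable {Γ}

theorem IsReduced.wordLength_eq {w : List (Σ v, G v)} (hw : IsReduced Γ w) :
    wordLength Γ (wordProd Γ w) = w.length := by
  have h := (exists_isReduced Γ (wordProd Γ w)).choose_spec
  exact (shuffle_of_wordProd_eq h.1 hw h.2).perm.length_eq

theorem wordLength_wordProd_le (w : List (Σ v, G v)) :
    wordLength Γ (wordProd Γ w) ≤ w.length := by
  obtain ⟨w', h1, h2, h3, -⟩ := exists_isReduced_of_word (Γ := Γ) w
  rw [← h2, h1.wordLength_eq]
  exact h3

theorem IsReduced.of_append_right {P Z : List (Σ v, G v)} (h : IsReduced Γ (P ++ Z)) :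
    IsReduced Γ Z := by
  induction P with
  | nil => exact h
  | cons x P ih => exact ih (isReduced_cons.1 h).2.2

/-- By the normal form theorem, one front-free reduced expression makes all of them front-free. -/
theorem IsReduced.not_hasFrontFree {v : V} {a : G v} {Z : List (Σ v, G v)}
    (h : IsReduced Γ (⟨v, a⟩ :: Z)) : ¬ HasFrontFree Γ v (wordProd Γ (⟨v, a⟩ :: Z)) := by
  rintro ⟨w, h1, h2, h3⟩
  exact (((shuffle_of_wordProd_eq h1 h h3).frontFree_iff v).1 h2).1 rfl

theorem exists_first_of_not_forall {X : Type*} {p : X → Prop} {l : List X}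
    (h : ¬ ∀ x ∈ l, p x) : ∃ l₁ x l₂, l = l₁ ++ x :: l₂ ∧ (∀ y ∈ l₁, p y) ∧ ¬ p x := by
  induction l with
  | nil => simp at h
  | cons y l ih =>
    by_cases hy : p y
    · obtain ⟨l₁, x, l₂, rfl, h1, h2⟩ := ih (by simpa [hy] using h)
      exact ⟨y :: l₁, x, l₂, rfl, by simpa [hy] using h1, h2⟩
    · exact ⟨[], y, l, rfl, by simp, hy⟩

/-- For finitely many elements that are not all trivial there is a coset `p * G v` such that each
of them either projects onto `p` in this coset or lies in `p * G v * ⟨G u | u ∈ link v⟩`; removing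
the `G v` component in the second case shortens the elements. -/
theorem exists_outermost_coset {ι : Type*} [Fintype ι] (s : ι → GraphProduct Γ G)
    (hs : ∃ i, s i ≠ 1) :
    ∃ (v : V) (p : GraphProduct Γ G) (a : ι → G v) (t : ι → GraphProduct Γ G),
      ∑ i, wordLength Γ (t i) < ∑ i, wordLength Γ (s i) ∧
      ∀ i, (a i = 1 ∧ t i = s i ∧ HasFrontFree Γ v (p⁻¹ * s i)) ∨
        ∃ u : List (Σ v, G v), (∀ x ∈ u, Γ.Adj v x.1) ∧
          s i = p * of Γ v (a i) * wordProd Γ u ∧ t i = p * wordProd Γ u := by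
  classical
  -- The coset will be `P * G v` for a longest blocked prefix `P` among the given elements;
  -- maximality forces the tails into the link of `v`.
  let Cand : ℕ → Prop := fun k => ∃ (i : ι) (v : V) (a : G v) (P Z : List (Σ v, G v)),
    P.length = k ∧ EndsBlocked Γ v P ∧ IsReduced Γ (P ++ ⟨v, a⟩ :: Z) ∧
      wordProd Γ (P ++ ⟨v, a⟩ :: Z) = s i
  have hbound : ∀ k, Cand k → k ≤ ∑ i, wordLength Γ (s i) := by
    rintro k ⟨i, v, a, P, Z, rfl, -, h1, h2⟩
    refine le_trans ?_ (Finset.single_le_sum (f := fun i => wordLength Γ (s i))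
      (fun _ _ => Nat.zero_le _) (Finset.mem_univ i))
    change P.length ≤ wordLength Γ (s i)
    rw [← h2, h1.wordLength_eq]
    simp
  have hcand : Cand 0 := by
    obtain ⟨i, hi⟩ := hs
    obtain ⟨w, hw, hwi⟩ := exists_isReduced Γ (s i)
    cases w with
    | nil => exact absurd hwi.symm hi
    | cons x Z => exact ⟨i, x.1, x.2, [], Z, rfl, trivial, hw, hwi⟩
  obtain ⟨i₀, v, a₀, P, Z₀, hlen, hP, hred₀, hprod₀⟩ :=
    Nat.findGreatest_spec (Nat.zero_le (∑ i, wordLength Γ (s i))) hcand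
  have hmax : ∀ k, Cand k → k ≤ P.length := fun k hk => by
    rw [hlen]
    exact Nat.le_findGreatest (hbound k hk) hk
  have hPa : IsReduced Γ (P ++ [⟨v, a₀⟩]) := by
    apply IsReduced.of_append (Z := Z₀)
    simpa using hred₀
  have hfar : ∀ i, ∃ (a : G v) (t : GraphProduct Γ G),
      ((a = 1 ∧ t = s i ∧ HasFrontFree Γ v ((wordProd Γ P)⁻¹ * s i)) ∨
        ∃ u : List (Σ v, G v), (∀ x ∈ u, Γ.Adj v x.1) ∧
          s i = wordProd Γ P * of Γ v a * wordProd Γ u ∧ t = wordProd Γ P * wordProd Γ u) ∧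
      wordLength Γ t ≤ wordLength Γ (s i) ∧
      (¬ HasFrontFree Γ v ((wordProd Γ P)⁻¹ * s i) → wordLength Γ t < wordLength Γ (s i)) := by
    intro i
    by_cases hff : HasFrontFree Γ v ((wordProd Γ P)⁻¹ * s i)
    · exact ⟨1, s i, .inl ⟨rfl, rfl, hff⟩, le_rfl, fun h => absurd hff h⟩
    obtain ⟨a, z, ⟨Z, hZ, hZv, rfl⟩, hz⟩ := exists_of_mul_hasFrontFree v ((wordProd Γ P)⁻¹ * s i)
    have ha : a ≠ 1 := by
      rintro rfl
      exact hff ⟨Z, hZ, hZv, by rw [hz, map_one, one_mul]⟩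
    have hsi : s i = wordProd Γ P * of Γ v a * wordProd Γ Z := by
      rw [mul_assoc, ← hz, mul_inv_cancel_left]
    have hred : IsReduced Γ (P ++ ⟨v, a⟩ :: Z) :=
      hP.isReduced_append hPa (isReduced_cons.2 ⟨ha, hZv, hZ⟩)
    have hprod : wordProd Γ (P ++ ⟨v, a⟩ :: Z) = s i := by simp [hsi, mul_assoc]
    -- Otherwise take the first letter `c` of `Z` not adjacent to `v`, and move behind `c` those
    -- letters before it that commute out of the way. The rest `U₁` is blocked by `c`, so `P`, `a`,
    -- `U₁` form a longer blocked prefix.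
    have hlink : ∀ x ∈ Z, Γ.Adj v x.1 := by
      by_contra hcon
      obtain ⟨U, c, Z', rfl, hU, hc⟩ := exists_first_of_not_forall hcon
      obtain ⟨U₁, U₂, hU₁, hU₂, hsh⟩ := EndsBlocked.exists_split (Γ := Γ) c.1 U
      have hshuffle : Shuffle Γ (P ++ ⟨v, a⟩ :: (U ++ c :: Z'))
          ((P ++ ⟨v, a⟩ :: U₁) ++ c :: (U₂ ++ Z')) := by
        have h1 : Shuffle Γ (U ++ c :: Z') (U₁ ++ c :: (U₂ ++ Z')) := by
          refine (hsh.append_right _).trans ?_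
          rw [List.append_assoc]
          exact (Shuffle.cons_append hU₂ Z').symm.append_left U₁
        simpa using (Shuffle.cons ⟨v, a⟩ h1).append_left P
      have := hmax _ ⟨i, c.1, c.2, P ++ ⟨v, a⟩ :: U₁, U₂ ++ Z', rfl, hP.append hU₁ hc a,
        hshuffle.isReduced hred, by rw [← hprod]; exact hshuffle.wordProd_eq.symm⟩
      simp at this
    have hlt : wordLength Γ (wordProd Γ P * wordProd Γ Z) < wordLength Γ (s i) := by
      rw [← hprod, hred.wordLength_eq, ← wordProd_append]
      refine lt_of_le_of_lt (wordLength_wordProd_le _) ?_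
      simp
    exact ⟨a, _, .inr ⟨Z, hlink, hsi, rfl⟩, hlt.le, fun _ => hlt⟩
  choose a t h1 h2 h3 using hfar
  refine ⟨v, wordProd Γ P, a, t, ?_, h1⟩
  -- The element that supplied `P` has its own letter `a₀` right behind `P`, so it does get shorter.
  refine Finset.sum_lt_sum (fun i _ => h2 i) ⟨i₀, Finset.mem_univ _, h3 i₀ ?_⟩
  rw [← hprod₀, wordProd_append, inv_mul_cancel_left]
  exact hred₀.of_append_right.not_hasFrontFree

end Length

/-! ### The word formula and its invariance under shuffles -/

section Multiplier

variable {V : Type*} {Γ : SimpleGraph V} {G : V → Type*} [∀ v, Group (G v)]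
  {A : Type*} [CStarAlgebra A]

theorem starAlgEquiv_mem_center (e : A ≃⋆ₐ[ℂ] A) {c : A} (hc : c ∈ Set.center A) :
    e c ∈ Set.center A := by
  rw [Semigroup.mem_center_iff] at hc ⊢
  intro x
  have := congrArg e (hc (e.symm x))
  simpa using this

theorem map_mul_apply {H : Type*} [Group H] (β : H →* (A ≃⋆ₐ[ℂ] A)) (g k : H) (x : A) :
    β (g * k) x = β g (β k x) := by
  rw [map_mul]; rfl

theorem map_one_apply {H : Type*} [Group H] (β : H →* (A ≃⋆ₐ[ℂ] A)) (x : A) : β 1 x = x := by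
  rw [map_one]; rfl

variable {β : GraphProduct Γ G →* (A ≃⋆ₐ[ℂ] A)} {h : ∀ v, G v → A}

theorem wordMultiplier_cons (x : Σ v, G v) (w : List (Σ v, G v)) :
    wordMultiplier Γ β h (x :: w) =
      β (wordProd Γ w)⁻¹ (h x.1 x.2) * wordMultiplier Γ β h w := by
  rw [wordMultiplier, map_inv]

theorem wordMultiplier_append (w w' : List (Σ v, G v)) :
    wordMultiplier Γ β h (w ++ w') =
      β (wordProd Γ w')⁻¹ (wordMultiplier Γ β h w) * wordMultiplier Γ β h w' := by
  induction w with
  | nil => simp [wordMultiplier]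
  | cons x w ih =>
    rw [List.cons_append, wordMultiplier_cons, ih, wordMultiplier_cons, wordProd_append,
      mul_inv_rev, map_mul_apply, map_mul, mul_assoc]

theorem wordMultiplier_singleton (x : Σ v, G v) : wordMultiplier Γ β h [x] = h x.1 x.2 := by
  simp [wordMultiplier]

theorem wordMultiplier_mem_center (hc : ∀ v g, h v g ∈ Set.center A) (w : List (Σ v, G v)) :
    wordMultiplier Γ β h w ∈ Set.center A := by
  induction w with
  | nil => exact Set.one_mem_center
  | cons x w ih =>
    rw [wordMultiplier_cons]
    exact Set.mul_mem_center (starAlgEquiv_mem_center _ (hc _ _)) ih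

theorem apply_inv_of_apply_eq {H : Type*} [Group H] {β : H →* (A ≃⋆ₐ[ℂ] A)} {g : H} {x : A}
    (hx : β g x = x) : β g⁻¹ x = x := by
  conv_lhs => rw [← hx]
  rw [← map_mul_apply, inv_mul_cancel, map_one_apply]

theorem apply_wordProd_of_adj
    (hfix : ∀ v w, Γ.Adj v w → ∀ (a : G v) (b : G w), β (of Γ v a) (h w b) = h w b)
    {v : V} {u : List (Σ v, G v)} (hu : ∀ x ∈ u, Γ.Adj v x.1) (c : G v) :
    β (wordProd Γ u) (h v c) = h v c := by
  induction u with
  | nil => simp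
  | cons x u ih =>
    rw [wordProd_cons, map_mul_apply, ih fun y hy => hu y (by simp [hy]),
      hfix x.1 v (hu x (by simp)).symm]

/-- The letter `a` commutes with every suffix of `u`, so it passes through the twisting automorphism
and reaches a multiplier value that it fixes. -/
theorem apply_wordMultiplier_of_adj
    (hfix : ∀ v w, Γ.Adj v w → ∀ (a : G v) (b : G w), β (of Γ v a) (h w b) = h w b)
    {v : V} {u : List (Σ v, G v)} (hu : ∀ x ∈ u, Γ.Adj v x.1) (a : G v) :
    β (of Γ v a) (wordMultiplier Γ β h u) = wordMultiplier Γ β h u := by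
  induction u with
  | nil => simp [wordMultiplier]
  | cons x u ih =>
    have hu' : ∀ y ∈ u, Γ.Adj v y.1 := fun y hy => hu y (by simp [hy])
    rw [wordMultiplier_cons, map_mul, ih hu', ← map_mul_apply,
      (commute_wordProd Γ v a u hu').inv_right.eq, map_mul_apply, hfix v x.1 (hu x (by simp))]

theorem Shuffle.wordMultiplier_eq (hc : ∀ v g, h v g ∈ Set.center A)
    (hfix : ∀ v w, Γ.Adj v w → ∀ (a : G v) (b : G w), β (of Γ v a) (h w b) = h w b)
    {w w' : List (Σ v, G v)} (hw : Shuffle Γ w w') :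
    wordMultiplier Γ β h w = wordMultiplier Γ β h w' := by
  induction hw with
  | nil => rfl
  | cons x hw ih => rw [wordMultiplier_cons, wordMultiplier_cons, ih, hw.wordProd_eq]
  | swap x y w hxy =>
    simp only [wordMultiplier_cons, wordProd_cons, mul_inv_rev, map_mul_apply,
      apply_inv_of_apply_eq (hfix y.1 x.1 hxy.symm y.2 x.2),
      apply_inv_of_apply_eq (hfix x.1 y.1 hxy x.2 y.2), ← mul_assoc]
    rw [Semigroup.mem_center_iff.1 (starAlgEquiv_mem_center _ (hc y.1 y.2))]
  | trans _ _ ih₁ ih₂ => exact ih₁.trans ih₂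

/-! ### Kernel of a function `φ` given by the word formula on reduced words -/

variable {φ : GraphProduct Γ G → A}
  (hφ : ∀ w : List (Σ v, G v), IsReduced Γ w → φ (wordProd Γ w) = wordMultiplier Γ β h w)

include hφ

theorem multiplier_one : φ 1 = 1 := hφ [] isReduced_nil

theorem multiplier_of_mul (h1 : ∀ v, h v 1 = 1) {v : V} (c : G v) {m : GraphProduct Γ G}
    (hm : HasFrontFree Γ v m) : φ (of Γ v c * m) = β m⁻¹ (h v c) * φ m := by
  obtain ⟨w, hw, hwv, rfl⟩ := hm
  by_cases hc : c = 1
  · subst hc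
    simp [h1]
  · have := hφ (⟨v, c⟩ :: w) (isReduced_cons.2 ⟨hc, hwv, hw⟩)
    rw [wordProd_cons, wordMultiplier_cons] at this
    rw [this, hφ w hw]

theorem multiplier_inv_mul_of (h1 : ∀ v, h v 1 = 1) {v : V} (c : G v) {m : GraphProduct Γ G}
    (hm : HasFrontFree Γ v m) :
    φ (m⁻¹ * of Γ v c) = β (of Γ v c)⁻¹ (φ m⁻¹) * h v c := by
  obtain ⟨w, hw, hwv, rfl⟩ := hm
  by_cases hc : c = 1
  · subst hc
    simp [h1]
  -- The word for `m⁻¹ c` is the formal inverse of `c⁻¹` followed by `w`, which turns front-freeness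
  -- of `m` into reducedness at the end.
  · have hred : IsReduced Γ (invWord (⟨v, c⁻¹⟩ :: w)) :=
      (isReduced_cons.2 ⟨inv_ne_one.2 hc, hwv, hw⟩).invWord
    have := hφ _ hred
    rw [invWord_cons, wordMultiplier_append, wordMultiplier_singleton, wordProd_append,
      wordProd_invWord] at this
    rw [← wordProd_invWord, hφ _ hw.invWord, wordProd_invWord]
    simpa using this

theorem multiplier_apply_of_adj
    (hfix : ∀ v w, Γ.Adj v w → ∀ (a : G v) (b : G w), β (of Γ v a) (h w b) = h w b)
    {v : V} {u : List (Σ v, G v)} (hu : ∀ x ∈ u, Γ.Adj v x.1) (a : G v) :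
    β (of Γ v a) (φ (wordProd Γ u)) = φ (wordProd Γ u) := by
  obtain ⟨w, h1, h2, -, h4⟩ := exists_isReduced_of_word (Γ := Γ) u
  rw [← h2, hφ w h1]
  exact apply_wordMultiplier_of_adj hfix (h4 _ hu) a

/-- The kernel of the multiplier factors over the coset `p * G v`. -/
theorem multiplier_kernel_eq_mul (hc : ∀ v g, h v g ∈ Set.center A) (h1 : ∀ v, h v 1 = 1)
    (hfix : ∀ v w, Γ.Adj v w → ∀ (a : G v) (b : G w), β (of Γ v a) (h w b) = h w b)
    {v : V} {p s t s' t' : GraphProduct Γ G} {a b : G v}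
    (hs : (a = 1 ∧ s' = s ∧ HasFrontFree Γ v (p⁻¹ * s)) ∨
        ∃ u : List (Σ v, G v), (∀ x ∈ u, Γ.Adj v x.1) ∧
          s = p * of Γ v a * wordProd Γ u ∧ s' = p * wordProd Γ u)
    (ht : (b = 1 ∧ t' = t ∧ HasFrontFree Γ v (p⁻¹ * t)) ∨
        ∃ u : List (Σ v, G v), (∀ x ∈ u, Γ.Adj v x.1) ∧
          t = p * of Γ v b * wordProd Γ u ∧ t' = p * wordProd Γ u) :
    β t (φ (s⁻¹ * t)) =
      β t' (φ (s'⁻¹ * t')) * β p (β (of Γ v b) (h v (a⁻¹ * b))) := by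
  rcases hs with ⟨rfl, rfl, hs⟩ | ⟨w, hw, rfl, rfl⟩ <;>
    rcases ht with ⟨rfl, rfl, ht⟩ | ⟨u, hu, rfl, rfl⟩
  -- Neither point has a component: the extra factor is `h v 1 = 1`.
  · simp [h1]
  -- Only `t` has a component: `b` commutes with `u` and is split off at the right end of `s⁻¹ t`;
  -- `u` fixes `h v b`.
  · have hub := commute_wordProd Γ v b u hu
    have hm := multiplier_inv_mul_of hφ h1 b (hs.wordProd_inv_mul hu)
    have e1 : ((wordProd Γ u)⁻¹ * (p⁻¹ * s'))⁻¹ = s'⁻¹ * (p * wordProd Γ u) := by group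
    rw [e1] at hm
    have e2 : s'⁻¹ * (p * of Γ v b * wordProd Γ u) =
        s'⁻¹ * (p * wordProd Γ u) * of Γ v b := by
      rw [mul_assoc p, hub.eq]; group
    rw [e2, hm, mul_assoc p, hub.eq, ← mul_assoc, map_mul, map_mul_apply, ← map_mul_apply,
      ← map_mul_apply, mul_inv_cancel_right]
    congr 1
    rw [← map_mul_apply, mul_assoc, ← hub.eq]
    simp only [map_mul_apply, apply_wordProd_of_adj hfix hu, inv_one, one_mul]
  -- Only `s` has a component: `a⁻¹` is split off at the left end, so the factors come out in the
  -- wrong order and centrality swaps them.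
  · have hm := multiplier_of_mul hφ h1 a⁻¹ (ht.wordProd_inv_mul hw)
    have hwa := commute_wordProd Γ v a w hw
    have e2 : (p * of Γ v a * wordProd Γ w)⁻¹ * t' =
        of Γ v a⁻¹ * ((wordProd Γ w)⁻¹ * (p⁻¹ * t')) := by
      rw [mul_assoc p, hwa.eq, map_inv]; group
    have e3 : (p * wordProd Γ w)⁻¹ * t' = (wordProd Γ w)⁻¹ * (p⁻¹ * t') := by group
    have hcen := starAlgEquiv_mem_center (β p) (hc v a⁻¹)
    rw [e2, e3, hm, map_mul, ← map_mul_apply]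
    have e4 : t' * ((wordProd Γ w)⁻¹ * (p⁻¹ * t'))⁻¹ = p * wordProd Γ w := by group
    rw [e4, map_mul_apply, apply_wordProd_of_adj hfix hw, mul_one, map_one, map_one_apply,
      Semigroup.mem_center_iff.1 hcen]
  -- Both have components: `p` cancels and `a⁻¹ b` separates from `w⁻¹ u`, a product over the link
  -- of `v` whose value under `φ` is fixed by `G v`.
  · have hub := commute_wordProd Γ v b u hu
    have huc := commute_wordProd Γ v (a⁻¹ * b) u hu
    have hm := multiplier_inv_mul_of hφ h1 (a⁻¹ * b)
      (((hasFrontFree_one (Γ := Γ) v).wordProd_mul hw).wordProd_inv_mul hu)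
    have hwu : ∀ x ∈ invWord w ++ u, Γ.Adj v x.1 := by
      intro x hx
      rcases List.mem_append.1 hx with hx | hx
      · simp only [invWord, List.mem_reverse, List.mem_map] at hx
        obtain ⟨y, hy, rfl⟩ := hx
        exact hw y hy
      · exact hu x hx
    have e1 : ((wordProd Γ u)⁻¹ * (wordProd Γ w * 1))⁻¹ = wordProd Γ (invWord w ++ u) := by
      rw [wordProd_append, wordProd_invWord]; group
    rw [e1, apply_inv_of_apply_eq (multiplier_apply_of_adj hφ hfix hwu (a⁻¹ * b))] at hm
    have e2 : (p * of Γ v a * wordProd Γ w)⁻¹ * (p * of Γ v b * wordProd Γ u) =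
        wordProd Γ (invWord w ++ u) * of Γ v (a⁻¹ * b) := by
      rw [wordProd_append, wordProd_invWord, mul_assoc _ (wordProd Γ u), ← huc.eq, map_mul,
        map_inv]
      group
    have e3 : (p * wordProd Γ w)⁻¹ * (p * wordProd Γ u) = wordProd Γ (invWord w ++ u) := by
      rw [wordProd_append, wordProd_invWord]; group
    rw [e2, e3, hm, map_mul]
    congr 1
    · rw [mul_assoc p, hub.eq, ← mul_assoc, map_mul_apply,
        multiplier_apply_of_adj hφ hfix hwu]
    · rw [map_mul_apply, apply_wordProd_of_adj hfix hu, map_mul_apply]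

variable [PartialOrder A] [StarOrderedRing A]

theorem multiplier_kernel_nonneg (hc : ∀ v g, h v g ∈ Set.center A) (h1 : ∀ v, h v 1 = 1)
    (hfix : ∀ v w, Γ.Adj v w → ∀ (a : G v) (b : G w), β (of Γ v a) (h w b) = h w b)
    (hφc : ∀ s, φ s ∈ Set.center A)
    (hpos : ∀ (v : V) (n : ℕ) (x : Fin n → G v),
      0 ≤ (CStarMatrix.ofMatrix (Matrix.of fun i j => β (of Γ v (x j)) (h v ((x i)⁻¹ * x j))) :
        CStarMatrix (Fin n) (Fin n) A))
    (n : ℕ) (s : Fin n → GraphProduct Γ G) :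
    0 ≤ (CStarMatrix.ofMatrix (Matrix.of fun i j => β (s j) (φ ((s i)⁻¹ * s j))) :
      CStarMatrix (Fin n) (Fin n) A) := by
  induction hN : ∑ i, wordLength Γ (s i) using Nat.strong_induction_on generalizing s with
  | _ N ih =>
    by_cases hs : ∃ i, s i ≠ 1
    · obtain ⟨v, p, a, t, hlt, hst⟩ := exists_outermost_coset s hs
      have hM := ih _ (hN ▸ hlt) t rfl
      have hK := nonneg_map_starAlgEquiv (β p) (hpos v n a)
      -- The central entries are those of the kernel at the shortened points.
      have := nonneg_hadamard_of_mem_center hM hK fun i j => starAlgEquiv_mem_center _ (hφc _)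
      refine this.trans_eq ?_
      ext i j
      exact (multiplier_kernel_eq_mul hφ hc h1 hfix (hst i) (hst j)).symm
    · push Not at hs
      refine (nonneg_one_entries n).trans_eq ?_
      ext i j
      change 1 = β (s j) (φ ((s i)⁻¹ * s j))
      simp [hs, multiplier_one hφ]

end Multiplier

end GraphProd

theorem theorem5p1 {V : Type*} (Γ : SimpleGraph V)
    {A : Type*} [CStarAlgebra A] [PartialOrder A] [StarOrderedRing A]
    {G : V → Type*} [∀ v, Group (G v)]
    (α : ∀ v, G v →* (A ≃⋆ₐ[ℂ] A)) (h : ∀ v, G v → A)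
    (hpos : ∀ v, GraphProd.IsPosDefMultiplier (α v) (h v))
    (hunital : ∀ v, GraphProd.IsUnitalMultiplier (h v))
    (hα : GraphProd.ActionsCommuteAccordingTo Γ α)
    (hh : GraphProd.MultipliersCommuteAccordingTo Γ α h) :
    (∀ w : List (Σ v, G v), GraphProd.IsReduced Γ w →
      GraphProd.graphProductMultiplier Γ α hα h (GraphProd.wordProd Γ w) =
        GraphProd.wordMultiplier Γ (GraphProd.graphProductAction Γ α hα) h w) ∧
    GraphProd.IsPosDefMultiplier (GraphProd.graphProductAction Γ α hα)
      (GraphProd.graphProductMultiplier Γ α hα h) := by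
  have hβ : ∀ v (g : G v), GraphProd.graphProductAction Γ α hα (GraphProd.of Γ v g) = α v g :=
    fun v g => GraphProd.lift_of Γ α hα v g
  have hc : ∀ v g, h v g ∈ Set.center A := fun v => (hpos v).mem_center
  have hfix : ∀ v w, Γ.Adj v w → ∀ (a : G v) (b : G w),
      GraphProd.graphProductAction Γ α hα (GraphProd.of Γ v a) (h w b) = h w b := by
    intro v w hvw a b
    rw [hβ]
    exact (hh v w hvw).1 a b
  have hwell : ∀ w : List (Σ v, G v), GraphProd.IsReduced Γ w →
      GraphProd.graphProductMultiplier Γ α hα h (GraphProd.wordProd Γ w) =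
        GraphProd.wordMultiplier Γ (GraphProd.graphProductAction Γ α hα) h w := by
    intro w hw
    have hspec := (GraphProd.exists_isReduced Γ (GraphProd.wordProd Γ w)).choose_spec
    exact (GraphProd.shuffle_of_wordProd_eq hspec.1 hw hspec.2).wordMultiplier_eq hc hfix
  have hcen : ∀ s, GraphProd.graphProductMultiplier Γ α hα h s ∈ Set.center A :=
    fun s => GraphProd.wordMultiplier_mem_center hc _
  refine ⟨hwell, hcen, GraphProd.multiplier_kernel_nonneg hwell hc hunital hfix hcen ?_⟩
  intro v n x
  simp only [hβ]
  exact (hpos v).nonneg n x
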